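/- Let $\mathbb K$ be a commutative ring in which $2$ and $3$ are invertible. A linear Jordan pair over $\mathbb K$ is a pair $(V^+,V^-)$ of $\mathbb K$-modules with $\mathbb K$-trilinear maps $T^\pm:V^\pm\times V^\mp\times V^\pm\to V^\pm$ satisfying $$T^\pm(x,y,z)=T^\pm(z,y,x),$$ $$T^\pm(u,v,T^\pm(x,y,z))=T^\pm(T^\pm(u,v,x),y,z)-T^\pm(x,T^\mp(v,u,y),z)+T^\pm(x,y,T^\pm(u,v,z)).$$ Put $Q(x)=Q^\pm(x)=\tfrac12T^\pm(x,\cdot,x):V^\mp\to V^\pm$ and, for $x\in V^+$, $y\in V^-$, $B(x,y)=\mathrm{id}_{V^+}-T^+(x,y,\cdot)+Q^+(x)Q^-(y)\in\mathrm{End}_{\mathbb K}(V^+)$. The pair $(x,y)$ is quasi-invertible if $B(x,y)$ is invertible, and then $\widetilde\tau_y(x)=B(x,y)^{-1}(x-Q(x)y)$ is its quasi-inverse. For $v\in V^+$ let $\tau_v(z)=z+v$. A reflection space is a set $M$ with maps $\sigma_x:M\to M$ $(x\in M)$ such that $\sigma_x(x)=x$, $\sigma_x\circ\sigma_x=\mathrm{id}_M$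 and $\sigma_x\sigma_y\sigma_x=\sigma_{\sigma_x(y)}$. For a base point $o\in M$, its quadratic map is $\mathcal Q(x)=\sigma_x\circ\sigma_o$ and its inversion is $\sigma_o$; they determine the reflection space by $\sigma_x=\mathcal Q(x)\circ\sigma_o$. **Theorem 2.3.** Let $(V^+,V^-)$ be a linear Jordan pair over $\mathbb K$, let $a\in V^-$ be arbitrary, and let $$\mathcal U_a=\{x\in V^+\mid B(x,-a)\text{ is invertible}\}$$ be the set of all $x\in V^+$ such that $(x,-a)$ is quasi-invertible. For $x\in\mathcal U_a$ put $$\mathcal Q(x)=\tau_{2x+Q(x)a}\circ B(x,-a),\qquad \sigma_0=-\widetilde\tau_{-a}.$$ 1. For every $x\in\mathcal U_a$ the pair $(-x,a)$ is quasi-invertible and $-\widetilde\tau_{-a}(x)=\widetilde\tau_a(-x)$, i.e. $\sigma_0=\widetilde\tau_a\circ(-\mathrm{id})$ on $\mathcal U_a$. 2. The set $\mathcal U_a$ is stable under $\sigma_0$ and under $\mathcal Q(x)$ for all $x\in\mathcal U_a$. 3. $(\mathcal U_a,\mathcal Q,\sigma_0)$ is a reflection space with base point $0$: $0\in\mathcal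 U_a$, the maps $\sigma_x=\mathcal Q(x)\circ\sigma_0$ $(x\in\mathcal U_a)$ make $\mathcal U_a$ a reflection space, its symmetry at $0$ is $\sigma_0$, and its quadratic map with respect to $0$ is $\mathcal Q$. 4. For every $x\in\mathcal U_a$ the algebraic differential $D\sigma_x(x)$ of $\sigma_x$ at its fixed point $x$ exists and equals $-\mathrm{id}_{V^+}$. This means: let $\mathbb K[\varepsilon]$, $\varepsilon^2=0$, be the dual numbers, let $(V^+\otimes_{\mathbb K}\mathbb K[\varepsilon],V^-\otimes_{\mathbb K}\mathbb K[\varepsilon])$ be the scalar extension of the Jordan pair, and extend $\mathcal U_a$ and $\sigma_x$ to it by the same formulas. Then $D=-\mathrm{id}_{V^+}$ is the unique $D\in\mathrm{End}_{\mathbb K}(V^+)$ such that for all $v\in V^+$ the element $x+\varepsilon v$ lies in the extended set $\mathcal U_a$ and $\sigma_x(x+\varepsilon v)=\sigma_x(x)+\varepsilon Dv$. Thus $\mathcal U_a$ is a symmetric space in the algebraic sense, that is, a reflection space in which the differential of each symmetry at its fixed point is minus the identity. -/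

import Mathlib

open scoped TensorProduct

/-- A linear Jordan pair over `K`: two modules `Vp = V⁺`, `Vm = V⁻` with trilinear maps
`T⁺ : V⁺ × V⁻ × V⁺ → V⁺` and `T⁻ : V⁻ × V⁺ × V⁻ → V⁻`. -/
structure LinearJordanPair (K : Type*) [CommRing K] (Vp Vm : Type*)
    [AddCommGroup Vp] [Module K Vp] [AddCommGroup Vm] [Module K Vm] where
  Tp : Vp →ₗ[K] Vm →ₗ[K] Vp →ₗ[K] Vp
  Tm : Vm →ₗ[K] Vp →ₗ[K] Vm →ₗ[K] Vm
  Tp_symm : ∀ (x : Vp) (y : Vm) (z : Vp), Tp x y z = Tp z y x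
  Tm_symm : ∀ (x : Vm) (y : Vp) (z : Vm), Tm x y z = Tm z y x
  Tp_jordan : ∀ (u : Vp) (v : Vm) (x : Vp) (y : Vm) (z : Vp),
    Tp u v (Tp x y z) = Tp (Tp u v x) y z - Tp x (Tm v u y) z + Tp x y (Tp u v z)
  Tm_jordan : ∀ (u : Vm) (v : Vp) (x : Vm) (y : Vp) (z : Vm),
    Tm u v (Tm x y z) = Tm (Tm u v x) y z - Tm x (Tp v u y) z + Tm x y (Tm u v z)

/-- A reflection space structure on `M`: a family of symmetries `σ_x = sym x`. -/
structure ReflectionSpace (M : Type*) where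
  sym : M → M → M
  sym_self : ∀ x, sym x x = x
  sym_comp_self : ∀ x, sym x ∘ sym x = id
  sym_comp_sym : ∀ x y, sym x ∘ sym y ∘ sym x = sym (sym x y)

/-- The quadratic map `𝒬(x) = σ_x ∘ σ_o` of a reflection space with base point `o`. -/
def ReflectionSpace.quadraticMap {M : Type*} (S : ReflectionSpace M) (o x : M) : M → M :=
  S.sym x ∘ S.sym o

namespace LinearJordanPair

section Operators

variable {K Vp Vm : Type*} [CommRing K] [Invertible (2 : K)]
  [AddCommGroup Vp] [Module K Vp] [AddCommGroup Vm] [Module K Vm]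
  (P : LinearJordanPair K Vp Vm)

/-- `Q⁺(x) = ½ T⁺(x, ·, x)`. -/
def Qp (x : Vp) : Vm →ₗ[K] Vp := (⅟2 : K) • (P.Tp x).flip x

/-- `Q⁻(y) = ½ T⁻(y, ·, y)`. -/
def Qm (y : Vm) : Vp →ₗ[K] Vm := (⅟2 : K) • (P.Tm y).flip y

/-- The Bergman operator `B(x, y) = id - T⁺(x, y) + Q⁺(x) Q⁻(y)` on `V⁺`. -/
def bergman (x : Vp) (y : Vm) : Module.End K Vp :=
  LinearMap.id - P.Tp x y + P.Qp x ∘ₗ P.Qm y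

/-- `(x, y)` is quasi-invertible if `B(x, y)` is an invertible linear map. -/
def QuasiInvertible (x : Vp) (y : Vm) : Prop := IsUnit (P.bergman x y)

/-- The quasi-inverse `x^y = B(x, y)⁻¹ (x - Q(x) y)`, used for quasi-invertible `(x, y)` only. -/
noncomputable def quasiInverse (y : Vm) (x : Vp) : Vp :=
  Ring.inverse (P.bergman x y) (x - P.Qp x y)

/-- The set `𝒰_a` of all `x` such that `(x, -a)` is quasi-invertible. -/
def U (a : Vm) : Set Vp := {x | P.QuasiInvertible x (-a)}

/-- `𝒬(x)`: first apply `B(x, -a)`, then translate by `2x + Q(x) a`. -/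
def calQ (a : Vm) (x y : Vp) : Vp :=
  P.bergman x (-a) y + ((2 : K) • x + P.Qp x a)

/-- `σ₀`: minus the quasi-inverse by `-a`. -/
noncomputable def sigmaZero (a : Vm) (y : Vp) : Vp := -P.quasiInverse (-a) y

/-- The symmetry `σ_x = 𝒬(x) ∘ σ₀`. -/
noncomputable def sigma (a : Vm) (x y : Vp) : Vp := P.calQ a x (P.sigmaZero a y)

end Operators

section BaseChange

variable {K : Type*} [CommRing K] (R : Type*) [CommRing R] [Algebra K R]

/-- The `R`-trilinear extension of a `K`-trilinear map to `R ⊗ M`. -/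
noncomputable def trilinearBaseChange {M N L : Type*}
    [AddCommGroup M] [Module K M] [AddCommGroup N] [Module K N] [AddCommGroup L] [Module K L]
    (T : M →ₗ[K] N →ₗ[K] M →ₗ[K] L) :
    R ⊗[K] M →ₗ[R] R ⊗[K] N →ₗ[R] R ⊗[K] M →ₗ[R] R ⊗[K] L :=
  LinearMap.liftBaseChange R
    (((LinearMap.liftBaseChangeEquiv R).toLinearMap.restrictScalars K ∘ₗ
      LinearMap.llcomp K N (M →ₗ[K] L) (R ⊗[K] M →ₗ[R] R ⊗[K] L)
        (LinearMap.baseChangeHom K R M L)) ∘ₗ T)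

theorem trilinearBaseChange_tmul {M N L : Type*}
    [AddCommGroup M] [Module K M] [AddCommGroup N] [Module K N] [AddCommGroup L] [Module K L]
    (T : M →ₗ[K] N →ₗ[K] M →ₗ[K] L) (r s t : R) (x : M) (y : N) (z : M) :
    trilinearBaseChange R T (r ⊗ₜ x) (s ⊗ₜ y) (t ⊗ₜ z) = (r * s * t) ⊗ₜ[K] T x y z := by
  simp [trilinearBaseChange, TensorProduct.smul_tmul', mul_assoc]

variable {Vp Vm : Type*} [AddCommGroup Vp] [Module K Vp] [AddCommGroup Vm] [Module K Vm]

theorem trilinearBaseChange_symm {M N L : Type*}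
    [AddCommGroup M] [Module K M] [AddCommGroup N] [Module K N] [AddCommGroup L] [Module K L]
    (T : M →ₗ[K] N →ₗ[K] M →ₗ[K] L) (hT : ∀ x y z, T x y z = T z y x)
    (x : R ⊗[K] M) (y : R ⊗[K] N) (z : R ⊗[K] M) :
    trilinearBaseChange R T x y z = trilinearBaseChange R T z y x := by
  induction x with
  | zero => simp
  | add x x' h h' => simp [h, h']
  | tmul r x =>
  induction y with
  | zero => simp
  | add y y' h h' => simp [h, h']
  | tmul s y =>
  induction z with
  | zero => simp
  | add z z' h h' => simp [h, h']
  | tmul t z =>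
  rw [trilinearBaseChange_tmul, trilinearBaseChange_tmul, hT x y z,
    show r * s * t = t * s * r by ring]

theorem trilinearBaseChange_jordan
    (T : Vp →ₗ[K] Vm →ₗ[K] Vp →ₗ[K] Vp) (T' : Vm →ₗ[K] Vp →ₗ[K] Vm →ₗ[K] Vm)
    (hT : ∀ u v x y z, T u v (T x y z) = T (T u v x) y z - T x (T' v u y) z + T x y (T u v z))
    (u : R ⊗[K] Vp) (v : R ⊗[K] Vm) (x : R ⊗[K] Vp) (y : R ⊗[K] Vm) (z : R ⊗[K] Vp) :
    trilinearBaseChange R T u v (trilinearBaseChange R T x y z) =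
      trilinearBaseChange R T (trilinearBaseChange R T u v x) y z -
      trilinearBaseChange R T x (trilinearBaseChange R T' v u y) z +
      trilinearBaseChange R T x y (trilinearBaseChange R T u v z) := by
  induction u with
  | zero => simp
  | add u u' h h' => simp only [map_add, LinearMap.add_apply, h, h']; abel
  | tmul r₁ u =>
  induction v with
  | zero => simp
  | add v v' h h' => simp only [map_add, LinearMap.add_apply, h, h']; abel
  | tmul r₂ v =>
  induction x with
  | zero => simp
  | add x x' h h' => simp only [map_add, LinearMap.add_apply, h, h']; abel
  | tmul r₃ x =>
  induction y with
  | zero => simp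
  | add y y' h h' => simp only [map_add, LinearMap.add_apply, h, h']; abel
  | tmul r₄ y =>
  induction z with
  | zero => simp
  | add z z' h h' => simp only [map_add, h, h']; abel
  | tmul r₅ z =>
  simp only [trilinearBaseChange_tmul]
  rw [hT, TensorProduct.tmul_add, TensorProduct.tmul_sub]
  rw [show r₁ * r₂ * r₃ * r₄ * r₅ = r₁ * r₂ * (r₃ * r₄ * r₅) by ring,
    show r₃ * (r₂ * r₁ * r₄) * r₅ = r₁ * r₂ * (r₃ * r₄ * r₅) by ring,
    show r₃ * r₄ * (r₁ * r₂ * r₅) = r₁ * r₂ * (r₃ * r₄ * r₅) by ring]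

/-- The scalar extension `(R ⊗ V⁺, R ⊗ V⁻)` of a linear Jordan pair. -/
noncomputable def baseChange (P : LinearJordanPair K Vp Vm) :
    LinearJordanPair R (R ⊗[K] Vp) (R ⊗[K] Vm) where
  Tp := trilinearBaseChange R P.Tp
  Tm := trilinearBaseChange R P.Tm
  Tp_symm := trilinearBaseChange_symm R P.Tp P.Tp_symm
  Tm_symm := trilinearBaseChange_symm R P.Tm P.Tm_symm
  Tp_jordan := trilinearBaseChange_jordan R P.Tp P.Tm P.Tp_jordan
  Tm_jordan := trilinearBaseChange_jordan R P.Tm P.Tp P.Tm_jordan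

end BaseChange

section Differential

instance invertibleTwoDualNumber (K : Type*) [CommRing K] [Invertible (2 : K)] :
    Invertible (2 : DualNumber K) :=
  (Invertible.map (algebraMap K (DualNumber K)) (2 : K)).copy 2 (map_ofNat _ 2).symm

variable {K Vp Vm : Type*} [CommRing K] [Invertible (2 : K)]
  [AddCommGroup Vp] [Module K Vp] [AddCommGroup Vm] [Module K Vm]

/-- `D` is the algebraic differential at `y` of the symmetry `σ_x` of `𝒰_a`: after extending
scalars to the dual numbers `K[ε]`, for all `v ∈ V⁺` the point `y + ε v` lies in the extended set
`𝒰_a`, and `σ_x (y + ε v) = σ_x (y) + ε D v` for the extended symmetry. -/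
def HasAlgDifferentialAt (P : LinearJordanPair K Vp Vm) (a : Vm) (x y : Vp)
    (D : Module.End K Vp) : Prop :=
  ∀ v : Vp,
    ((1 : DualNumber K) ⊗ₜ[K] y + (DualNumber.eps : DualNumber K) ⊗ₜ[K] v) ∈
      (P.baseChange (DualNumber K)).U (1 ⊗ₜ[K] a) ∧
    (P.baseChange (DualNumber K)).sigma (1 ⊗ₜ[K] a) (1 ⊗ₜ[K] x)
        ((1 : DualNumber K) ⊗ₜ[K] y + (DualNumber.eps : DualNumber K) ⊗ₜ[K] v) =
      (1 : DualNumber K) ⊗ₜ[K] P.sigma a x y + (DualNumber.eps : DualNumber K) ⊗ₜ[K] D v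

end Differential

end LinearJordanPair

/-! The product `½ T⁺(x, a, y)` makes `V⁺` a Jordan algebra; adjoin a unit to get `K × V⁺`. Its
quadratic operators preserve the affine hyperplane `1 + V⁺`: there `(1, x)` acts by `calQ a x`, and
on the direction space `V⁺` by `B(x, -a)` (`hullPair_Qp`). The fundamental formula `Q(Q(x)y) =
Q(x)Q(y)Q(x)` in the hull therefore yields `calQ_calQ` and `bergman_calQ`. On `𝒰_a`, `σ₀` is Jordan
inversion: `σ₀ x` is the only solution `s` of `calQ a x s = x`. The reflection axioms then follow by
the formal calculus of inverses. For the differential, inversion is expanded to first order in any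
`ε` with `ε² = 0`, using `T(X, X⁻¹, ·) = 2 id` in the hull; the dual numbers are a special case. -/

theorem invertible_smul_cancel {K V : Type*} [CommRing K] [AddCommGroup V] [Module K V] (k : K)
    [Invertible k] {x y : V} (h : k • x = k • y) : x = y :=
  (isUnit_of_invertible k).smul_left_cancel.1 h

namespace LinearJordanPair

/-! ### Identities in a linear Jordan pair -/

section Identities

variable {K Vp Vm : Type*} [CommRing K] [AddCommGroup Vp] [Module K Vp]
  [AddCommGroup Vm] [Module K Vm] (P : LinearJordanPair K Vp Vm)

/-- The opposite pair, with the roles of `V⁺` and `V⁻` exchanged. -/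
def swap : LinearJordanPair K Vm Vp where
  Tp := P.Tm
  Tm := P.Tp
  Tp_symm := P.Tm_symm
  Tm_symm := P.Tp_symm
  Tp_jordan := P.Tm_jordan
  Tm_jordan := P.Tp_jordan

/-- Swapping `y` and `v` in the Jordan identity gives `A = 2B - C` and `B = 2A - C` for the two
sides `A`, `B` and a common `C`; hence `3A = 3B`. -/
theorem Tp_shift [Invertible (3 : K)] (x : Vp) (y v : Vm) :
    P.Tp x y (P.Tp x v x) = P.Tp (P.Tp x y x) v x := by
  have h1 := P.Tp_jordan x y x v x
  have h2 := P.Tp_jordan x v x y x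
  rw [P.Tp_symm (P.Tp x v x) y x, P.Tm_symm v x y] at h2
  rw [P.Tp_symm x v (P.Tp x y x)] at h1 h2
  apply invertible_smul_cancel (3 : K)
  linear_combination (norm := module) h1 - h2

theorem Tp_shift_middle [Invertible (3 : K)] (x : Vp) (y v : Vm) :
    P.Tp x (P.Tm y x v) x = P.Tp x y (P.Tp x v x) := by
  have h1 := P.Tp_jordan x y x v x
  rw [P.Tp_symm x v (P.Tp x y x), ← P.Tp_shift] at h1
  linear_combination (norm := module) h1

theorem Tp_exchange (x : Vp) (y : Vm) (z : Vp) :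
    P.Tp (P.Tp x y x) y z = P.Tp x (P.Tm y x y) z := by
  have h := P.Tp_jordan x y x y z
  linear_combination (norm := module) -h

theorem Tp_exchange_polarized (x : Vp) (y v : Vm) (z : Vp) :
    P.Tp (P.Tp x y x) v z + P.Tp (P.Tp x v x) y z = (2 : K) • P.Tp x (P.Tm y x v) z := by
  have h := P.Tp_exchange x (y + v) z
  simp only [map_add, LinearMap.add_apply, P.Tp_exchange x y, P.Tp_exchange x v,
    P.Tm_symm v x y] at h
  linear_combination (norm := module) h

/-- Expresses `Q(x)Q(a)` through products with only `a` in the middle, so that the homotope algebra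
sees the Bergman operator. -/
theorem Tp_middle_square (z : Vp) (a : Vm) (x : Vp) :
    P.Tp x (P.Tm a z a) x = (2 : K) • P.Tp x a (P.Tp x a z) - P.Tp (P.Tp x a x) a z := by
  have h := P.Tp_jordan z a x a x
  rw [P.Tp_symm (P.Tp z a x), P.Tp_symm z a x, P.Tp_symm z a] at h
  linear_combination (norm := module) h

theorem Tp_fundamental [Invertible (3 : K)] (x : Vp) (y z : Vm) :
    P.Tp (P.Tp x y x) z (P.Tp x y x) = P.Tp x (P.Tm y (P.Tp x z x) y) x := by
  have h := P.Tp_jordan (P.Tp x y x) z x y x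
  have e := P.Tp_shift_middle x (P.Tm y x z) y
  have m := P.swap.Tp_middle_square z x y
  rw [P.Tm_symm _ x y, P.Tp_shift] at e
  have n := P.swap.Tp_exchange y x z
  simp only [swap] at m n
  -- The shift rules bring every term of `h` to the form `T(x, ·, x)`; the middle entries are then
  -- compared by `m`.
  rw [← P.Tp_shift x y z, ← P.Tp_shift_middle x y z, ← e, ← P.Tp_shift_middle x y, P.Tm_symm z,
    ← n] at h
  rw [m, map_sub, LinearMap.sub_apply, map_smul, LinearMap.smul_apply]
  linear_combination (norm := module) h

/-- This is the Jordan identity of the homotope: multiplication by `x` commutes with multiplication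
by its square. Eliminating the other triple products from three relations leaves three times the
claim. -/
theorem Tp_square_comm [Invertible (3 : K)] (x : Vp) (a : Vm) (z : Vp) :
    P.Tp x a (P.Tp (P.Tp x a x) a z) = P.Tp (P.Tp x a x) a (P.Tp x a z) := by
  have h1 := P.Tp_jordan x a (P.Tp x a x) a z
  have h2 := P.Tp_jordan (P.Tp x a x) a x a z
  have h3 := P.Tp_exchange_polarized x a (P.Tm a x a) z
  have h4 := P.swap.Tp_jordan a x a x a
  simp only [swap] at h4
  rw [P.Tp_shift_middle] at h3
  rw [P.Tm_symm (P.Tm a x a)] at h4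
  rw [P.Tp_symm (P.Tp x a x) a x] at h2
  have h5 : P.Tm a (P.Tp x a x) a = P.Tm a x (P.Tm a x a) := by
    linear_combination (norm := module) h4
  rw [h5] at h2
  apply invertible_smul_cancel (3 : K)
  linear_combination (norm := module) h1 - (2 : K) • h2 - h3

variable [Invertible (2 : K)]

theorem Qp_apply (x : Vp) (y : Vm) : P.Qp x y = (⅟2 : K) • P.Tp x y x := rfl

theorem Qm_apply (y : Vm) (x : Vp) : P.Qm y x = (⅟2 : K) • P.Tm y x y := rfl

theorem two_smul_Qp (x : Vp) (y : Vm) : (2 : K) • P.Qp x y = P.Tp x y x := by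
  rw [Qp_apply, smul_invOf_smul]

theorem two_smul_Qm (y : Vm) (x : Vp) : (2 : K) • P.Qm y x = P.Tm y x y := by
  rw [Qm_apply, smul_invOf_smul]

theorem Qp_fundamental [Invertible (3 : K)] (x : Vp) (y z : Vm) :
    P.Qp (P.Qp x y) z = P.Qp x (P.Qm y (P.Qp x z)) := by
  have h := P.Tp_fundamental x y z
  simp only [← two_smul_Qp, ← two_smul_Qm] at h
  simp only [Qp_apply, Qm_apply, map_smul, LinearMap.smul_apply, smul_smul] at h ⊢
  apply invertible_smul_cancel (2 : K)
  apply invertible_smul_cancel (2 : K)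
  apply invertible_smul_cancel (2 : K)
  simp only [smul_smul]
  convert h using 2 <;> ring

end Identities

/-! ### From Jordan algebras to Jordan pairs -/

section JordanProduct

variable {K J : Type*} [CommRing K] [AddCommGroup J] [Module K J]

theorem jordan_linearized [Invertible (2 : K)] (m : J →ₗ[K] J →ₗ[K] J)
    (comm : ∀ x y, m x y = m y x) (jordan : ∀ x y, m x (m (m x x) y) = m (m x x) (m x y))
    (x y z w : J) :
    m x (m (m y z) w) + m y (m (m z x) w) + m z (m (m x y) w) =
      m (m y z) (m x w) + m (m z x) (m y w) + m (m x y) (m z w) := by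
  have h1 := jordan (x + y + z) w
  have h2 := jordan (x + y) w
  have h3 := jordan (y + z) w
  have h4 := jordan (x + z) w
  have hx := jordan x w
  have hy := jordan y w
  have hz := jordan z w
  simp only [map_add, LinearMap.add_apply, comm y x, comm z y, comm x z] at h1 h2 h3 h4 ⊢
  apply invertible_smul_cancel (2 : K)
  linear_combination (norm := module) h1 - h2 - h3 - h4 + hx + hy + hz

/-- Commutators of multiplication operators are derivations: subtract two linearized Jordan
identities with `x` and `y` exchanged. -/
theorem lmul_lie_derivation [Invertible (2 : K)] (m : J →ₗ[K] J →ₗ[K] J)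
    (comm : ∀ x y, m x y = m y x) (jordan : ∀ x y, m x (m (m x x) y) = m (m x x) (m x y))
    (x y z w : J) :
    m x (m y (m z w)) - m y (m x (m z w)) =
      m (m x (m y z) - m y (m x z)) w + m z (m x (m y w) - m y (m x w)) := by
  have h1 := jordan_linearized m comm jordan x z w y
  have h2 := jordan_linearized m comm jordan y z w x
  simp only [map_sub, LinearMap.sub_apply]
  rw [comm (m z w) y, comm (m w x) y, comm (m x z) y, comm w x] at h1
  rw [comm (m z w) x, comm (m w y) x, comm (m y z) x, comm w y] at h2
  rw [comm w (m y (m x z)), comm z] at h1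
  rw [comm w (m x (m y z)), comm z] at h2
  rw [comm z y, comm w y] at h1
  rw [comm z x, comm w x] at h2
  rw [comm (m x w) (m y z), comm (m x z)] at h1
  rw [comm y x] at h2
  rw [comm w z] at h1 h2
  linear_combination (norm := module) h1 - h2

/-- The Jordan pair `(J, J)` of a Jordan algebra, with
`T(x, y, z) = 2 ((x y) z + x (y z) - y (x z))`. -/
def ofJordanProduct [Invertible (2 : K)] (m : J →ₗ[K] J →ₗ[K] J)
    (comm : ∀ x y, m x y = m y x) (jordan : ∀ x y, m x (m (m x x) y) = m (m x x) (m x y)) :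
    LinearJordanPair K J J :=
  let T : J →ₗ[K] J →ₗ[K] J →ₗ[K] J :=
    LinearMap.mk₂ K (fun x y => (2 : K) • (m (m x y) + m x ∘ₗ m y - m y ∘ₗ m x))
      (fun _ _ _ => by ext; simp; module) (fun _ _ _ => by ext; simp; module)
      (fun _ _ _ => by ext; simp; module) (fun _ _ _ => by ext; simp; module)
  have symm : ∀ x y z, T x y z = T z y x := fun x y z => by
    simp only [T, LinearMap.mk₂_apply, LinearMap.smul_apply, LinearMap.sub_apply,
      LinearMap.add_apply, LinearMap.comp_apply]
    rw [comm (m x y) z, comm x (m y z), comm x z, comm x y, comm y z]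
    module
  have main : ∀ u v x y z, T u v (T x y z) = T (T u v x) y z - T x (T v u y) z + T x y (T u v z) :=
    fun u v x y z => by
    have hT : ∀ x y z, T x y z = (2 : K) • (m (m x y) z + m x (m y z) - m y (m x z)) :=
      fun _ _ _ => rfl
    -- `T(u, v) = 2(L_{uv} + d)` and `T(v, u) = 2(L_{uv} - d)`. The derivation `d` respects the
    -- triple product, so only the contribution of `L_{uv}` remains; `h1` and `h2` settle it.
    obtain ⟨d, hd⟩ : ∃ d : J →ₗ[K] J, ∀ p, d p = m u (m v p) - m v (m u p) :=
      ⟨m u ∘ₗ m v - m v ∘ₗ m u, fun _ => rfl⟩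
    have hder : ∀ p q, d (m p q) = m (d p) q + m p (d q) := fun p q => by
      simp only [hd]
      exact lmul_lie_derivation m comm jordan u v p q
    have huv : ∀ p, T u v p = (2 : K) • (m (m u v) p + d p) := fun p => by
      rw [hT, hd]; module
    have hvu : ∀ p, T v u p = (2 : K) • (m (m u v) p - d p) := fun p => by
      rw [hT, hd, comm v u]; module
    have h1 := jordan_linearized m comm jordan (m u v) x y z
    have h2 := lmul_lie_derivation m comm jordan x y (m u v) z
    simp only [huv, hvu, hT, map_add, map_sub, map_smul, LinearMap.add_apply, LinearMap.sub_apply,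
      LinearMap.smul_apply, hder] at h1 h2 ⊢
    rw [comm y (m u v)] at h1 h2
    rw [comm x (m u v)] at h2
    rw [comm (m (m u v) x) y]
    linear_combination (norm := module) (4 : K) • h1 - (4 : K) • h2
  { Tp := T, Tm := T, Tp_symm := symm, Tm_symm := symm, Tp_jordan := main, Tm_jordan := main }

end JordanProduct

/-! ### The unital hull of the `a`-homotope -/

section Hull

variable {K Vp Vm : Type*} [CommRing K] [Invertible (2 : K)] [AddCommGroup Vp] [Module K Vp]
  [AddCommGroup Vm] [Module K Vm] (P : LinearJordanPair K Vp Vm)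

theorem bergman_neg_apply (x : Vp) (a : Vm) (y : Vp) :
    P.bergman x (-a) y = y + P.Tp x a y + P.Qp x (P.Qm a y) := by
  simp [bergman, Qm_apply]

theorem Qp_Qm (x : Vp) (a : Vm) (y : Vp) :
    P.Qp x (P.Qm a y) = (⅟2 * ⅟2 : K) •
      ((2 : K) • P.Tp x a (P.Tp x a y) - P.Tp (P.Tp x a x) a y) := by
  rw [← P.Tp_middle_square, Qm_apply, map_smul, Qp_apply, smul_smul]

/-- The product of the unital hull `K ⊕ V⁺` of the homotope algebra `x · y = ½ T⁺(x, a, y)`. -/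
def hullMul (a : Vm) : (K × Vp) →ₗ[K] (K × Vp) →ₗ[K] (K × Vp) :=
  LinearMap.mk₂ K
    (fun X Y => (X.1 * Y.1, X.1 • Y.2 + Y.1 • X.2 + (⅟2 : K) • P.Tp X.2 a Y.2))
    (fun _ _ _ => by ext <;> simp <;> first | ring1 | module)
    (fun _ _ _ => by ext <;> simp <;> first | ring1 | module)
    (fun _ _ _ => by ext <;> simp <;> first | ring1 | module)
    (fun _ _ _ => by ext <;> simp <;> first | ring1 | module)

theorem hullMul_apply (a : Vm) (X Y : K × Vp) : P.hullMul a X Y =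
    (X.1 * Y.1, X.1 • Y.2 + Y.1 • X.2 + (⅟2 : K) • P.Tp X.2 a Y.2) := rfl

theorem hullMul_comm (a : Vm) (X Y : K × Vp) : P.hullMul a X Y = P.hullMul a Y X := by
  rw [hullMul_apply, hullMul_apply, P.Tp_symm X.2, mul_comm, add_comm (X.1 • Y.2)]

variable [Invertible (3 : K)]

theorem hullMul_jordan (a : Vm) (X Y : K × Vp) :
    P.hullMul a X (P.hullMul a (P.hullMul a X X) Y) =
      P.hullMul a (P.hullMul a X X) (P.hullMul a X Y) := by
  obtain ⟨k, x⟩ := X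
  obtain ⟨l, y⟩ := Y
  have h := P.Tp_square_comm x a y
  have h' := P.Tp_symm x a (P.Tp x a x)
  simp only [hullMul_apply, map_add, map_smul, LinearMap.add_apply, LinearMap.smul_apply, h, h']
  ext
  · simp only
    ring
  · simp only
    module

/-- The Jordan pair of the unital hull of the `a`-homotope of `V⁺`. -/
def hullPair (a : Vm) : LinearJordanPair K (K × Vp) (K × Vp) :=
  ofJordanProduct (P.hullMul a) (P.hullMul_comm a) (P.hullMul_jordan a)

theorem hullPair_Tp (a : Vm) (X Y Z : K × Vp) : (P.hullPair a).Tp X Y Z =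
    (2 : K) • (P.hullMul a (P.hullMul a X Y) Z + P.hullMul a X (P.hullMul a Y Z) -
      P.hullMul a Y (P.hullMul a X Z)) := rfl

theorem hullPair_Qp (a : Vm) (x y : Vp) (r : K) : (P.hullPair a).Qp (1, x) (r, y) =
    (r, P.bergman x (-a) y + r • ((2 : K) • x + P.Qp x a)) := by
  have h2 : (⅟2 : K) * 2 = 1 := invOf_mul_self 2
  have h' := P.Tp_symm (P.Tp x a y) a x
  rw [Qp_apply, hullPair_Tp, invOf_smul_smul, bergman_neg_apply, Qp_Qm]
  simp only [hullMul_apply, map_add, map_smul, LinearMap.add_apply, LinearMap.smul_apply,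
    Qp_apply, P.Tp_symm y a, h']
  ext
  · simp only [Prod.fst_sub, Prod.fst_add]
    ring
  · simp only [Prod.snd_sub, Prod.snd_add]
    match_scalars <;> grind

theorem hullPair_Qp_one (a : Vm) (x y : Vp) :
    (P.hullPair a).Qp (1, x) (1, y) = (1, P.calQ a x y) := by
  rw [hullPair_Qp, one_smul, calQ]

theorem hullPair_Qp_zero (a : Vm) (x y : Vp) :
    (P.hullPair a).Qp (1, x) (0, y) = (0, P.bergman x (-a) y) := by
  rw [hullPair_Qp, zero_smul, add_zero]

theorem calQ_calQ (a : Vm) (x y z : Vp) :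
    P.calQ a (P.calQ a x y) z = P.calQ a x (P.calQ a y (P.calQ a x z)) := by
  have h := (P.hullPair a).Qp_fundamental (1, x) (1, y) (1, z)
  rw [show (P.hullPair a).Qm = (P.hullPair a).Qp from rfl] at h
  simp only [hullPair_Qp_one] at h
  exact congrArg Prod.snd h

theorem bergman_calQ (a : Vm) (x y : Vp) : P.bergman (P.calQ a x y) (-a) =
    P.bergman x (-a) * P.bergman y (-a) * P.bergman x (-a) := by
  ext z
  have h := (P.hullPair a).Qp_fundamental (1, x) (1, y) (0, z)
  rw [show (P.hullPair a).Qm = (P.hullPair a).Qp from rfl] at h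
  simp only [hullPair_Qp_one, hullPair_Qp_zero] at h
  exact congrArg Prod.snd h

/-- With `X = (1, x)` and `S = (1, s)`, the hypothesis reads `Q(X)S = X`, so `Tp_shift` gives `T(X,
S, V) = 2V` for `V` in the image of `Q(X)`. The `V⁺`-component is the claim. -/
theorem polarized_of_calQ_eq_self (a : Vm) {x s : Vp} (h : P.calQ a x s = x) (z : Vp) :
    P.Tp (P.bergman x (-a) z) a s + P.Tp x (P.Qm a s) (P.bergman x (-a) z) +
      P.Tp x a (P.bergman x (-a) z) = 0 := by
  have e := (P.hullPair a).Tp_shift (1, x) (1, s) (0, z)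
  simp only [← two_smul_Qp, hullPair_Qp_one, hullPair_Qp_zero, h, map_smul,
    LinearMap.smul_apply] at e
  generalize P.bergman x (-a) z = v at *
  -- Trades the term with `Q(a)s` for iterated products through `a`, the only ones occurring in the
  -- hull.
  have j := P.Tp_jordan s a x a v
  rw [← two_smul_Qm] at j
  have e' := congrArg Prod.snd (invertible_smul_cancel (2 : K) e)
  rw [hullPair_Tp] at e'
  have h2 : (⅟2 : K) * 2 = 1 := invOf_mul_self 2
  simp only [hullMul_apply, map_add, map_smul, LinearMap.add_apply, LinearMap.smul_apply,
    Prod.smul_snd, Prod.snd_add, Prod.snd_sub, P.Tp_symm x a s] at e' j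
  rw [P.Tp_symm v a s]
  linear_combination (norm := skip) e' + (⅟2 : K) • j
  match_scalars <;> grind

end Hull

/-! ### Inversion and the reflection space -/

section Symmetries

variable {K Vp Vm : Type*} [CommRing K] [Invertible (2 : K)] [AddCommGroup Vp] [Module K Vp]
  [AddCommGroup Vm] [Module K Vm] (P : LinearJordanPair K Vp Vm)

theorem bergman_zero_left (y : Vm) : P.bergman 0 y = 1 := by
  ext z
  simp [bergman, Qp_apply]

theorem bergman_neg_left (x : Vp) (y : Vm) : P.bergman (-x) y = P.bergman x (-y) := by
  ext z
  simp [bergman, Qp_apply, Qm_apply]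

theorem Qp_neg_left (x : Vp) (y : Vm) : P.Qp (-x) y = P.Qp x y := by
  simp [Qp_apply]

theorem zero_mem_U (a : Vm) : (0 : Vp) ∈ P.U a := by
  simp [U, QuasiInvertible, bergman_zero_left]

theorem calQ_zero (a : Vm) (y : Vp) : P.calQ a 0 y = y := by
  simp [calQ, bergman_zero_left, Qp_apply]

theorem calQ_injective {a : Vm} {x : Vp} (hx : x ∈ P.U a) : Function.Injective (P.calQ a x) :=
  fun _ _ h => ((Module.End.isUnit_iff _).1 hx).injective (add_right_cancel h)

theorem sigmaZero_eq_quasiInverse_neg (a : Vm) (x : Vp) :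
    P.sigmaZero a x = P.quasiInverse a (-x) := by
  simp only [sigmaZero, quasiInverse, bergman_neg_left, Qp_neg_left, map_neg (P.Qp x)]
  rw [← map_neg]
  congr 1
  abel

theorem calQ_sigmaZero {a : Vm} {x : Vp} (hx : x ∈ P.U a) : P.calQ a x (P.sigmaZero a x) = x := by
  have h : P.bergman x (-a) * Ring.inverse (P.bergman x (-a)) = 1 := Ring.mul_inverse_cancel _ hx
  have h' := LinearMap.congr_fun h (x - P.Qp x (-a))
  rw [Module.End.mul_apply, Module.End.one_apply] at h'
  rw [sigmaZero, quasiInverse, calQ, map_neg, h', map_neg]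
  module

theorem sigmaZero_eq_of_calQ {a : Vm} {x s : Vp} (hx : x ∈ P.U a) (h : P.calQ a x s = x) :
    P.sigmaZero a x = s :=
  P.calQ_injective hx ((P.calQ_sigmaZero hx).trans h.symm)

variable [Invertible (3 : K)]

theorem calQ_mem_U {a : Vm} {x y : Vp} (hx : x ∈ P.U a) (hy : y ∈ P.U a) :
    P.calQ a x y ∈ P.U a := by
  simp only [U, QuasiInvertible, Set.mem_ofPred_eq] at *
  rw [bergman_calQ]
  exact (hx.mul hy).mul hx

theorem sigmaZero_mem_U {a : Vm} {x : Vp} (hx : x ∈ P.U a) : P.sigmaZero a x ∈ P.U a := by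
  have h := P.bergman_calQ a x (P.sigmaZero a x)
  rw [P.calQ_sigmaZero hx] at h
  obtain ⟨u, hu⟩ : IsUnit (P.bergman x (-a)) := hx
  -- Here `B_x = B_x B_s B_x` with `B_x` invertible and `s = σ₀ x`, so `B_s` is its inverse.
  rw [← hu, eq_comm, u.isUnit.mul_eq_right] at h
  exact ⟨u⁻¹, Units.mul_eq_one_iff_inv_eq.1 h⟩

theorem calQ_calQ_sigmaZero {a : Vm} {x : Vp} (hx : x ∈ P.U a) (z : Vp) :
    P.calQ a x (P.calQ a (P.sigmaZero a x) z) = z := by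
  have h : ∀ z, P.calQ a (P.sigmaZero a x) (P.calQ a x z) = z := fun z => by
    apply P.calQ_injective hx
    rw [← calQ_calQ, P.calQ_sigmaZero hx]
  apply P.calQ_injective (P.sigmaZero_mem_U hx)
  rw [h]

theorem calQ_sigmaZero_calQ {a : Vm} {x : Vp} (hx : x ∈ P.U a) (z : Vp) :
    P.calQ a (P.sigmaZero a x) (P.calQ a x z) = z := by
  apply P.calQ_injective hx
  rw [P.calQ_calQ_sigmaZero hx]

theorem sigmaZero_sigmaZero {a : Vm} {x : Vp} (hx : x ∈ P.U a) :
    P.sigmaZero a (P.sigmaZero a x) = x := by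
  apply P.sigmaZero_eq_of_calQ (P.sigmaZero_mem_U hx)
  nth_rw 2 [← P.calQ_sigmaZero hx]
  rw [P.calQ_sigmaZero_calQ hx]

theorem sigmaZero_calQ {a : Vm} {x y : Vp} (hx : x ∈ P.U a) (hy : y ∈ P.U a) :
    P.sigmaZero a (P.calQ a x y) = P.calQ a (P.sigmaZero a x) (P.sigmaZero a y) := by
  apply P.sigmaZero_eq_of_calQ (P.calQ_mem_U hx hy)
  rw [calQ_calQ, P.calQ_calQ_sigmaZero hx, P.calQ_sigmaZero hy]

/-- The reflection space `𝒰_a` with symmetries `σ_x`. -/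
noncomputable def reflectionSpace (a : Vm) : ReflectionSpace (P.U a) where
  sym x y := ⟨P.sigma a x y, P.calQ_mem_U x.2 (P.sigmaZero_mem_U y.2)⟩
  sym_self x := Subtype.ext (P.calQ_sigmaZero x.2)
  sym_comp_self x := by
    ext y
    simp only [Function.comp_apply, id, sigma]
    rw [P.sigmaZero_calQ x.2 (P.sigmaZero_mem_U y.2), P.calQ_calQ_sigmaZero x.2,
      P.sigmaZero_sigmaZero y.2]
  sym_comp_sym x y := by
    ext z
    have hz := P.sigmaZero_mem_U z.2
    simp only [Function.comp_apply, sigma]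
    rw [P.sigmaZero_calQ y.2 (P.sigmaZero_mem_U (P.calQ_mem_U x.2 hz)),
      P.sigmaZero_sigmaZero (P.calQ_mem_U x.2 hz), calQ_calQ]

end Symmetries

/-! ### First-order expansion at the fixed point -/

section Infinitesimal

variable {K Vp Vm : Type*} [CommRing K] [Invertible (2 : K)] [AddCommGroup Vp] [Module K Vp]
  [AddCommGroup Vm] [Module K Vm] (P : LinearJordanPair K Vp Vm)

theorem Qp_add_smul {ε : K} (hε : ε * ε = 0) (x v : Vp) (y : Vm) :
    P.Qp (x + ε • v) y = P.Qp x y + ε • P.Tp x y v := by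
  have h2 : (⅟2 : K) * 2 = 1 := invOf_mul_self 2
  simp only [Qp_apply, map_add, map_smul, LinearMap.add_apply, LinearMap.smul_apply,
    P.Tp_symm v y x]
  match_scalars <;> grind

theorem bergman_add_smul {ε : K} (hε : ε * ε = 0) (x v : Vp) (a : Vm) (s : Vp) :
    P.bergman (x + ε • v) (-a) s =
      P.bergman x (-a) s + ε • (P.Tp v a s + P.Tp x (P.Qm a s) v) := by
  simp only [bergman_neg_apply, P.Qp_add_smul hε, map_add, map_smul, LinearMap.add_apply,
    LinearMap.smul_apply]
  module

theorem add_smul_mem_U {a : Vm} {x : Vp} (hx : x ∈ P.U a) {ε : K} (hε : ε * ε = 0) (v : Vp) :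
    x + ε • v ∈ P.U a := by
  obtain ⟨u, hu⟩ : IsUnit (P.bergman x (-a)) := hx
  let N : Module.End K Vp := P.Tp v a + (P.Tp x).flip v ∘ₗ P.Qm a
  -- The perturbation is a unit times `1` plus a nilpotent.
  have h : P.bergman (x + ε • v) (-a) = u * (1 + ε • ((u⁻¹ : (Module.End K Vp)ˣ) * N)) := by
    rw [mul_add, mul_one, mul_smul_comm, Units.mul_inv_cancel_left, hu]
    ext s
    rw [P.bergman_add_smul hε]
    rfl
  have hn : IsNilpotent (ε • ((u⁻¹ : (Module.End K Vp)ˣ) * N)) :=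
    ⟨2, by rw [smul_pow, pow_two ε, hε, zero_smul]⟩
  change IsUnit _
  rw [h]
  exact u.isUnit.mul hn.isUnit_one_add

variable [Invertible (3 : K)]

theorem sigma_add_smul {a : Vm} {x : Vp} (hx : x ∈ P.U a) {ε : K} (hε : ε * ε = 0) (v : Vp) :
    P.sigma a x (x + ε • v) = x - ε • v := by
  obtain ⟨z, rfl⟩ := ((Module.End.isUnit_iff _).1 hx).surjective v
  have hs := P.calQ_sigmaZero hx
  have h0 := P.polarized_of_calQ_eq_self a hs z
  -- With `v = B(x, -a) z`, the inverse of `x + εv` is `σ₀ x - εz`. In the check, `h0` cancels all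
  -- first-order terms except `2v - v`.
  rw [sigma, P.sigmaZero_eq_of_calQ (s := P.sigmaZero a x - ε • z) (P.add_smul_mem_U hx hε _)]
  · simp only [calQ, map_sub, map_smul] at hs ⊢
    linear_combination (norm := module) hs
  · have h1 := congrArg (ε • ·) h0
    simp only [calQ, P.bergman_add_smul hε, P.Qp_add_smul hε, map_sub, map_smul, smul_add,
      smul_sub, smul_smul, hε, zero_smul, LinearMap.sub_apply, LinearMap.smul_apply, sub_zero,
      smul_zero] at hs h1 ⊢
    linear_combination (norm := module) hs + h1

end Infinitesimal

/-! ### Passage to the dual numbers -/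

section ScalarExtension

variable {K Vp Vm : Type*} [CommRing K] [Invertible (2 : K)] [AddCommGroup Vp] [Module K Vp]
  [AddCommGroup Vm] [Module K Vm] (P : LinearJordanPair K Vp Vm)

theorem bergman_baseChange (R : Type*) [CommRing R] [Algebra K R] [Invertible (2 : R)]
    (x : Vp) (y : Vm) :
    (P.baseChange R).bergman (1 ⊗ₜ[K] x) (1 ⊗ₜ[K] y) = (P.bergman x y).baseChange R := by
  have h2 : (⅟2 : R) = algebraMap K R ⅟2 := by
    apply invOf_eq_right_inv
    rw [← map_ofNat (algebraMap K R) 2, ← map_mul, mul_invOf_self, map_one]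
  have hp : ∀ u v w, (P.baseChange R).Tp (1 ⊗ₜ u) (1 ⊗ₜ v) (1 ⊗ₜ w) = 1 ⊗ₜ[K] P.Tp u v w :=
    fun u v w => (trilinearBaseChange_tmul R P.Tp 1 1 1 u v w).trans (by rw [mul_one, mul_one])
  have hm : ∀ u v w, (P.baseChange R).Tm (1 ⊗ₜ u) (1 ⊗ₜ v) (1 ⊗ₜ w) = 1 ⊗ₜ[K] P.Tm u v w :=
    fun u v w => (trilinearBaseChange_tmul R P.Tm 1 1 1 u v w).trans (by rw [mul_one, mul_one])
  ext z
  change (P.baseChange R).bergman (1 ⊗ₜ[K] x) (1 ⊗ₜ[K] y) (1 ⊗ₜ[K] z) = 1 ⊗ₜ[K] P.bergman x y z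
  simp only [bergman, Qp_apply, Qm_apply, LinearMap.sub_apply, LinearMap.add_apply,
    LinearMap.comp_apply, LinearMap.id_apply, hp, hm, h2, algebraMap_smul,
    ← TensorProduct.tmul_smul, TensorProduct.tmul_add, TensorProduct.tmul_sub]

theorem tmul_mem_U_baseChange (R : Type*) [CommRing R] [Algebra K R] [Invertible (2 : R)]
    {a : Vm} {x : Vp} (hx : x ∈ P.U a) : (1 : R) ⊗ₜ[K] x ∈ (P.baseChange R).U (1 ⊗ₜ[K] a) := by
  change IsUnit _
  rw [← TensorProduct.tmul_neg, bergman_baseChange]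
  have h : IsUnit (P.bergman x (-a)) := hx
  exact h.map (Module.End.baseChangeHom K R Vp)

/-- Reading off the `ε`-coefficient is a left inverse; this makes the differential unique. -/
theorem eps_tmul_injective (K M : Type*) [CommRing K] [AddCommGroup M] [Module K M] :
    Function.Injective fun v : M => (DualNumber.eps : DualNumber K) ⊗ₜ[K] v := by
  intro v w h
  have h' := congrArg
    ((TensorProduct.lid K M).toLinearMap ∘ₗ (TrivSqZeroExt.sndHom K K).rTensor M) h
  simpa using h'

variable [Invertible (3 : K)]

theorem hasAlgDifferentialAt_iff {a : Vm} {x : Vp} (hx : x ∈ P.U a) (D : Module.End K Vp) :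
    P.HasAlgDifferentialAt a x x D ↔ D = -LinearMap.id := by
  let _ : Invertible (3 : DualNumber K) :=
    (Invertible.map (algebraMap K (DualNumber K)) (3 : K)).copy 3 (map_ofNat _ 3).symm
  have hU := P.tmul_mem_U_baseChange (DualNumber K) hx
  have hs : P.sigma a x x = x := P.calQ_sigmaZero hx
  have heps : ∀ v : Vp, (DualNumber.eps : DualNumber K) ⊗ₜ[K] v =
      (DualNumber.eps : DualNumber K) • (1 : DualNumber K) ⊗ₜ[K] v := fun v => by
    rw [TensorProduct.smul_tmul', smul_eq_mul, mul_one]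
  have hmem := fun v : Vp =>
    (P.baseChange (DualNumber K)).add_smul_mem_U hU DualNumber.eps_mul_eps (1 ⊗ₜ[K] v)
  have hsigma := fun v : Vp =>
    (P.baseChange (DualNumber K)).sigma_add_smul hU DualNumber.eps_mul_eps (1 ⊗ₜ[K] v)
  simp only [← heps, sub_eq_add_neg, ← TensorProduct.tmul_neg] at hmem hsigma
  constructor
  · intro h
    ext v
    have e := (h v).2
    rw [hsigma, hs] at e
    exact (eps_tmul_injective K Vp (add_left_cancel e)).symm
  · rintro rfl v
    exact ⟨hmem v, by rw [hsigma, hs]; rfl⟩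

end ScalarExtension

end LinearJordanPair

theorem theorem2p3 {K : Type*} [CommRing K] [Invertible (2 : K)] [Invertible (3 : K)]
    {Vp Vm : Type*} [AddCommGroup Vp] [Module K Vp] [AddCommGroup Vm] [Module K Vm]
    (P : LinearJordanPair K Vp Vm) (a : Vm) :
    (∀ y ∈ P.U a, P.QuasiInvertible (-y) a ∧ P.sigmaZero a y = P.quasiInverse a (-y)) ∧
    (∀ x ∈ P.U a, Set.MapsTo (P.calQ a x) (P.U a) (P.U a)) ∧
    Set.MapsTo (P.sigmaZero a) (P.U a) (P.U a) ∧
    (∃ (S : ReflectionSpace (P.U a)) (o : P.U a),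
      (o : Vp) = 0 ∧
      (∀ y, (S.sym o y : Vp) = P.sigmaZero a y) ∧
      (∀ x y, (S.quadraticMap o x y : Vp) = P.calQ a x y) ∧
      (∀ x y, (S.sym x y : Vp) = P.sigma a x y)) ∧
    (∀ x ∈ P.U a, ∀ D : Module.End K Vp, P.HasAlgDifferentialAt a x x D ↔ D = -LinearMap.id) := by
  refine ⟨fun y hy => ⟨?_, P.sigmaZero_eq_quasiInverse_neg a y⟩, fun x hx y hy => P.calQ_mem_U hx hy,
    fun y hy => P.sigmaZero_mem_U hy, ⟨P.reflectionSpace a, ⟨0, P.zero_mem_U a⟩, rfl, fun y => ?_,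
      fun x y => ?_, fun _ _ => rfl⟩, fun x hx D => P.hasAlgDifferentialAt_iff hx D⟩
  · rw [LinearJordanPair.QuasiInvertible, P.bergman_neg_left]
    exact hy
  · exact P.calQ_zero a _
  · change P.calQ a x (P.sigmaZero a (P.calQ a 0 (P.sigmaZero a y))) = _
    rw [P.calQ_zero, P.sigmaZero_sigmaZero y.2]
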